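/- **Theorem.** Let $G$ be a finite group with pseudo-exponent $\alpha$ and character degrees $d_1,\dots,d_k$, and let $\omega$ be the exponent of matrix multiplication over $\mathbb{C}$. Then $$|G|^{\omega/\alpha}\;\le\;\sum_{i=1}^k d_i^{\,\omega}.$$ Here the terms are defined as follows. * For a finite subset $S\subseteq G$ put $Q(S)=\{s_1s_2^{-1}: s_1,s_2\in S\}$. The group $G$ *realizes* $\langle n,m,p\rangle$ if there are subsets $S_1,S_2,S_3\subseteq G$ with $|S_1|=n$, $|S_2|=m$, $|S_3|=p$ such that, for all $q_i\in Q(S_i)$, $q_1q_2q_3=1$ implies $q_1=q_2=q_3=1$. * The *pseudo-exponent* $\alpha=\alpha(G)$ of a non-trivial finite group $G$ is the minimum of $\dfrac{3\log|G|}{\log(nmp)}$ over all positive integers $n,m,p$, not all equal to $1$, such that $G$ realizes $\langle n,m,p\rangle$. The pseudo-exponent of the trivial group is $3$. * The *character degrees* of $G$ are the positive integers $d_1,\dots,d_k$ (listed with multiplicity) in a decomposition $\mathbb{C}[G]\cong\prod_{i=1}^k \mathbb{C}^{d_i\times d_i}$ of the group algebra as a direct product of matrix algebras. * $\omega$ is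 the smallest real number such that for every $\varepsilon>0$ two complex $n\times n$ matrices can be multiplied with $O(n^{\omega+\varepsilon})$ field operations. Field operations are counted in straight-line computations, which may differ for different $n$: starting from the matrix entries and arbitrary complex constants, each addition, subtraction, multiplication or division (by a quantity that is nonzero for all inputs) costs one operation. -/

import Mathlib

noncomputable section

/-! ### The triple product property and the pseudo-exponent -/

/-- The right quotient set `Q(S) = {s₁ s₂⁻¹ : s₁, s₂ ∈ S}`. -/
def rightQuotientSet {G : Type*} [Group G] (S : Finset G) : Set G :=
  {q | ∃ s₁ ∈ S, ∃ s₂ ∈ S, q = s₁ * s₂⁻¹}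

/-- The triple product property of three finite subsets of a group. -/
def TripleProductProperty {G : Type*} [Group G] (S₁ S₂ S₃ : Finset G) : Prop :=
  ∀ q₁ ∈ rightQuotientSet S₁, ∀ q₂ ∈ rightQuotientSet S₂, ∀ q₃ ∈ rightQuotientSet S₃,
    q₁ * q₂ * q₃ = 1 → q₁ = 1 ∧ q₂ = 1 ∧ q₃ = 1

/-- `G` realizes `⟨n₁, n₂, n₃⟩`. -/
def Realizes (G : Type*) [Group G] (n₁ n₂ n₃ : ℕ) : Prop :=
  ∃ S₁ S₂ S₃ : Finset G, S₁.card = n₁ ∧ S₂.card = n₂ ∧ S₃.card = n₃ ∧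
    TripleProductProperty S₁ S₂ S₃

/-- The values `3 log |G| / log (nmp)`, over all positive integers `n, m, p`, not all `1`, such
that `G` realizes `⟨n, m, p⟩`. -/
def pseudoExponentValues (G : Type*) [Group G] : Set ℝ :=
  {a | ∃ n m p : ℕ, 0 < n ∧ 0 < m ∧ 0 < p ∧ ¬ (n = 1 ∧ m = 1 ∧ p = 1) ∧ Realizes G n m p ∧
    a = 3 * Real.log (Nat.card G) / Real.log ((n * m * p : ℕ) : ℝ)}

open Classical in
/-- The pseudo-exponent `α(G)` of a finite group: the minimum of `pseudoExponentValues G` if `G`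
is non-trivial (see `isLeast_pseudoExponent`), and `3` if `G` is trivial. -/
def pseudoExponent (G : Type*) [Group G] : ℝ :=
  if Nontrivial G then sInf (pseudoExponentValues G) else 3

/-- For a non-trivial finite group the infimum in `pseudoExponent` is a minimum. -/
theorem isLeast_pseudoExponent (G : Type*) [Group G] [Finite G] [Nontrivial G] :
    IsLeast (pseudoExponentValues G) (pseudoExponent G) := by
  classical
  have := Fintype.ofFinite G
  have hfin : (pseudoExponentValues G).Finite := by
    have hsub : pseudoExponentValues G ⊆
        (fun t : Finset G × Finset G × Finset G =>
          3 * Real.log (Nat.card G) /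
            Real.log ((t.1.card * t.2.1.card * t.2.2.card : ℕ) : ℝ)) '' Set.univ := by
      rintro a ⟨n, m, p, -, -, -, -, ⟨S₁, S₂, S₃, rfl, rfl, rfl, -⟩, rfl⟩
      exact ⟨(S₁, S₂, S₃), trivial, rfl⟩
    exact (Set.finite_univ.image _).subset hsub
  have hne : (pseudoExponentValues G).Nonempty := by
    refine ⟨_, 1, 1, Fintype.card G, one_pos, one_pos, Fintype.card_pos, ?_,
      ⟨{1}, {1}, Finset.univ, by simp, by simp, by simp, ?_⟩, rfl⟩
    · have := Fintype.one_lt_card (α := G)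
      omega
    · rintro q₁ ⟨a, ha, b, hb, rfl⟩ q₂ ⟨c, hc, d, hd, rfl⟩ q₃ - h
      simp_all
  have hdef : pseudoExponent G = sInf (pseudoExponentValues G) := by
    unfold pseudoExponent
    rw [if_pos ‹Nontrivial G›]
  rw [hdef]
  exact ⟨hne.csInf_mem hfin, fun a ha => csInf_le hfin.bddBelow ha⟩

/-! ### Character degrees -/

/-- `d₁, …, d_k` are the character degrees of `G`, listed with multiplicity: the orders of the
matrix algebras in a decomposition of `ℂ[G]` as a direct product of matrix algebras over `ℂ`. -/
def IsCharacterDegrees (G : Type*) [Group G] {k : ℕ} (d : Fin k → ℕ) : Prop :=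
  (∀ i, 0 < d i) ∧
    Nonempty (MonoidAlgebra ℂ G ≃ₐ[ℂ] ((i : Fin k) → Matrix (Fin (d i)) (Fin (d i)) ℂ))

/-- Every finite group has character degrees. -/
theorem exists_isCharacterDegrees (G : Type*) [Group G] [Finite G] :
    ∃ (k : ℕ) (d : Fin k → ℕ), IsCharacterDegrees G d := by
  classical
  have := Fintype.ofFinite G
  have : NeZero (Nat.card G : ℂ) := ⟨by exact_mod_cast Nat.card_pos.ne'⟩
  obtain ⟨k, d, hd, e⟩ :=
    IsSemisimpleRing.exists_algEquiv_pi_matrix_of_isAlgClosed ℂ (MonoidAlgebra ℂ G)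
  exact ⟨k, d, fun i => Nat.pos_of_ne_zero (hd i).out, e⟩

/-! ### Field operations and the exponent of matrix multiplication -/

/-- Straight-line computations over `ℂ` with input variables indexed by `ι`.
`StraightLine L S` says that some sequence of `L` field operations makes exactly the functions in
`S` available: at the start these are the inputs and the complex constants, and each operation
`+`, `-`, `*`, `/` costs one step and adds its result, computed from two available functions (a
division is permitted only if the divisor vanishes at no input). -/
inductive StraightLine {ι : Type} : ℕ → Set ((ι → ℂ) → ℂ) → Prop
  | start : StraightLine 0 {f | (∃ i : ι, f = fun x => x i) ∨ ∃ c : ℂ, f = fun _ => c}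
  | add {L : ℕ} {S : Set ((ι → ℂ) → ℂ)} {f g : (ι → ℂ) → ℂ} :
      StraightLine L S → f ∈ S → g ∈ S → StraightLine (L + 1) (insert (fun x => f x + g x) S)
  | sub {L : ℕ} {S : Set ((ι → ℂ) → ℂ)} {f g : (ι → ℂ) → ℂ} :
      StraightLine L S → f ∈ S → g ∈ S → StraightLine (L + 1) (insert (fun x => f x - g x) S)
  | mul {L : ℕ} {S : Set ((ι → ℂ) → ℂ)} {f g : (ι → ℂ) → ℂ} :
      StraightLine L S → f ∈ S → g ∈ S → StraightLine (L + 1) (insert (fun x => f x * g x) S)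
  | div {L : ℕ} {S : Set ((ι → ℂ) → ℂ)} {f g : (ι → ℂ) → ℂ} :
      StraightLine L S → f ∈ S → g ∈ S → (∀ x, g x ≠ 0) →
        StraightLine (L + 1) (insert (fun x => f x / g x) S)

/-- The entries of two `n × n` matrices: the input variables of matrix multiplication. -/
abbrev MatMulVars (n : ℕ) : Type := (Fin n × Fin n) ⊕ (Fin n × Fin n)

/-- The left input matrix. -/
def leftMatrix {n : ℕ} (x : MatMulVars n → ℂ) : Matrix (Fin n) (Fin n) ℂ :=
  Matrix.of fun i j => x (Sum.inl (i, j))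

/-- The right input matrix. -/
def rightMatrix {n : ℕ} (x : MatMulVars n → ℂ) : Matrix (Fin n) (Fin n) ℂ :=
  Matrix.of fun i j => x (Sum.inr (i, j))

/-- Two complex `n × n` matrices can be multiplied with `L` field operations: some straight-line
computation of length `L` computes all entries of the product. -/
def MatMulInOps (n L : ℕ) : Prop :=
  ∃ S : Set ((MatMulVars n → ℂ) → ℂ), StraightLine L S ∧
    ∀ i j : Fin n, (fun x => (leftMatrix x * rightMatrix x) i j) ∈ S

/-- The exponent `ω` of matrix multiplication over `ℂ`: the smallest number `w` such that for each
`ε > 0`, `n × n` matrices can be multiplied with `O(n ^ (w + ε))` field operations. -/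
def matMulExponent : ℝ :=
  sInf {w : ℝ | ∀ ε : ℝ, 0 < ε → ∃ C : ℝ, ∀ n : ℕ, 0 < n →
    ∃ L : ℕ, (L : ℝ) ≤ C * (n : ℝ) ^ (w + ε) ∧ MatMulInOps n L}

end

/-! If `G` realizes ⟨n, m, p⟩, indexing matrix entries by `s₁⁻¹ * s₂` embeds the ⟨n, m, p⟩ matrix
multiplication tensor into the tensor of ℂ[G] (`TripleProductProperty.tensorRankLE`), while the
decomposition into matrix algebras writes the latter as a sum of tensors of formats ⟨dᵢ, dᵢ, dᵢ⟩
(`exists_groupTensor_eq_sum`). In the `l`-th tensor power the summands are square multiplications of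
size ∏ d (f t), so the rank `R` of the power satisfies R ≤ C (∑ dᵢ ^ (ω + ε)) ^ l. Symmetrizing the
embedded rectangular multiplication gives (nmp) ^ (lω) ≤ R ^ 3. Letting `l` tend to infinity removes
C, and then ε → 0 yields (nmp) ^ ω ≤ (∑ dᵢ ^ ω) ^ 3. For a realization attaining the
pseudo-exponent, nmp = |G| ^ (3/α), which leaves a cube root to take.

Since ω counts field operations, it must first be tied to tensor rank. A computation of length L
gives rank at most 2L, because quadratic parts only grow by products of linear forms
(`MatMulInOps.tensorRankLE`). Conversely, rank R for N × N matrices gives exponent log_N R by block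
recursion (`logb_mem_matMulExponentSet`). -/

noncomputable section

/-! ### Tensor rank -/

/-- The tensor with coordinates `T x y z` is a sum of `R` tensors of rank one. -/
def TensorRankLE {X Y Z : Type*} (T : X → Y → Z → ℂ) (R : ℕ) : Prop :=
  ∃ (u : Fin R → X → ℂ) (v : Fin R → Y → ℂ) (w : Fin R → Z → ℂ),
    ∀ x y z, T x y z = ∑ r, u r x * v r y * w r z

namespace TensorRankLE

variable {X Y Z X' Y' Z' : Type*}

theorem of_fintype {ρ : Type*} [Fintype ρ] {T : X → Y → Z → ℂ} (u : ρ → X → ℂ) (v : ρ → Y → ℂ)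
    (w : ρ → Z → ℂ) (h : ∀ x y z, T x y z = ∑ r, u r x * v r y * w r z) :
    TensorRankLE T (Fintype.card ρ) := by
  let e := (Fintype.equivFin ρ).symm
  refine ⟨fun r => u (e r), fun r => v (e r), fun r => w (e r), fun x y z => ?_⟩
  rw [h]
  exact (e.sum_comp fun r => u r x * v r y * w r z).symm

theorem comap {T : X → Y → Z → ℂ} {R : ℕ} (h : TensorRankLE T R) (a : X' → X) (b : Y' → Y)
    (c : Z' → Z) : TensorRankLE (fun x y z => T (a x) (b y) (c z)) R := by
  obtain ⟨u, v, w, h⟩ := h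
  exact ⟨fun r x => u r (a x), fun r y => v r (b y), fun r z => w r (c z), fun x y z => h _ _ _⟩

theorem rotate {T : X → Y → Z → ℂ} {R : ℕ} (h : TensorRankLE T R) :
    TensorRankLE (fun y z x => T x y z) R := by
  obtain ⟨u, v, w, h⟩ := h
  refine ⟨v, w, u, fun y z x => (h x y z).trans ?_⟩
  exact Finset.sum_congr rfl fun r _ => by ring

theorem mul {T : X → Y → Z → ℂ} {T' : X' → Y' → Z' → ℂ} {R R' : ℕ} (h : TensorRankLE T R)
    (h' : TensorRankLE T' R') :
    TensorRankLE (fun (x : X × X') (y : Y × Y') (z : Z × Z') => T x.1 y.1 z.1 * T' x.2 y.2 z.2)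
      (R * R') := by
  obtain ⟨u, v, w, h⟩ := h
  obtain ⟨u', v', w', h'⟩ := h'
  have := of_fintype (ρ := Fin R × Fin R')
    (T := fun (x : X × X') (y : Y × Y') (z : Z × Z') => T x.1 y.1 z.1 * T' x.2 y.2 z.2)
    (fun r x => u r.1 x.1 * u' r.2 x.2) (fun r y => v r.1 y.1 * v' r.2 y.2)
    (fun r z => w r.1 z.1 * w' r.2 z.2) (fun x y z => by
      rw [h, h', Finset.sum_mul_sum, Fintype.sum_prod_type]
      exact Finset.sum_congr rfl fun r _ => Finset.sum_congr rfl fun s _ => by ring)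
  simpa using this

theorem sum {σ : Type*} [Fintype σ] {T : σ → X → Y → Z → ℂ} {R : σ → ℕ}
    (h : ∀ s, TensorRankLE (T s) (R s)) :
    TensorRankLE (fun x y z => ∑ s, T s x y z) (∑ s, R s) := by
  choose u v w h using h
  have := of_fintype (ρ := (s : σ) × Fin (R s)) (T := fun x y z => ∑ s, T s x y z)
    (fun r => u r.1 r.2) (fun r => v r.1 r.2) (fun r => w r.1 r.2) (fun x y z => by
      rw [Fintype.sum_sigma]
      exact Finset.sum_congr rfl fun s _ => h s x y z)
  simpa using this

end TensorRankLE

/-! ### Ranks of matrix multiplication tensors -/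

/-- The tensor of the multiplication of `I × J` by `J × K` matrices, in its cyclically symmetric
form: the coefficients of `(A, B, C) ↦ tr (A * B * C)`. -/
def matMulTensor (I J K : Type*) [DecidableEq I] [DecidableEq J] [DecidableEq K] :
    I × J → J × K → K × I → ℂ :=
  fun x y z => if x.2 = y.1 ∧ y.2 = z.1 ∧ z.2 = x.1 then 1 else 0

section MatMulTensor

variable {I J K I' J' K' : Type*} [DecidableEq I] [DecidableEq J] [DecidableEq K]
  [DecidableEq I'] [DecidableEq J'] [DecidableEq K']

theorem TensorRankLE.matMulTensor_rotate {R : ℕ} (h : TensorRankLE (matMulTensor I J K) R) :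
    TensorRankLE (matMulTensor J K I) R := by
  convert h.rotate using 4 with x y z
  simp only [matMulTensor]
  congr 1
  exact propext (by tauto)

theorem TensorRankLE.matMulTensor_congr {R : ℕ} (h : TensorRankLE (matMulTensor I J K) R)
    (e : I' ≃ I) (f : J' ≃ J) (g : K' ≃ K) : TensorRankLE (matMulTensor I' J' K') R := by
  convert h.comap (Prod.map e f) (Prod.map f g) (Prod.map g e) using 4 with x y z
  simp [matMulTensor]

theorem TensorRankLE.matMulTensor_prod {R R' : ℕ} (h : TensorRankLE (matMulTensor I J K) R)
    (h' : TensorRankLE (matMulTensor I' J' K') R') :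
    TensorRankLE (matMulTensor (I × I') (J × J') (K × K')) (R * R') := by
  convert (h.mul h').comap
    (fun x : (I × I') × (J × J') => ((x.1.1, x.2.1), (x.1.2, x.2.2)))
    (fun x : (J × J') × (K × K') => ((x.1.1, x.2.1), (x.1.2, x.2.2)))
    (fun x : (K × K') × (I × I') => ((x.1.1, x.2.1), (x.1.2, x.2.2))) using 4 with x y z
  simp only [matMulTensor, Prod.ext_iff, mul_ite, mul_one, mul_zero]
  split_ifs <;> first | rfl | (exfalso; tauto)

/-- Symmetrization: multiplication of square matrices from a rectangular format. -/
theorem TensorRankLE.matMulTensor_square [Fintype I] [Fintype J] [Fintype K] {R : ℕ}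
    (h : TensorRankLE (matMulTensor I J K) R) :
    TensorRankLE (matMulTensor (Fin (Fintype.card I * Fintype.card J * Fintype.card K))
      (Fin (Fintype.card I * Fintype.card J * Fintype.card K))
      (Fin (Fintype.card I * Fintype.card J * Fintype.card K))) (R ^ 3) := by
  have h₂ := h.matMulTensor_rotate
  -- Multiplying the three cyclic rotations makes every side a product of I, J and K in some order.
  have h₃ := (h.matMulTensor_prod h₂).matMulTensor_prod h₂.matMulTensor_rotate
  rw [show R ^ 3 = R * R * R by ring]
  refine h₃.matMulTensor_congr (Fintype.equivOfCardEq ?_) (Fintype.equivOfCardEq ?_)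
    (Fintype.equivOfCardEq ?_) <;> simp only [Fintype.card_fin, Fintype.card_prod] <;> ring

/-- A tensor of the form `∑ i j k, a i j * b j k * c k i` restricts the matrix multiplication
tensor. -/
theorem TensorRankLE.of_matMulTensor [Fintype I] [Fintype J] [Fintype K] {X Y Z : Type*}
    {R : ℕ} (h : TensorRankLE (matMulTensor I J K) R) (a : X → I → J → ℂ) (b : Y → J → K → ℂ)
    (c : Z → K → I → ℂ) :
    TensorRankLE (fun x y z => ∑ i, ∑ j, ∑ k, a x i j * b y j k * c z k i) R := by
  obtain ⟨u, v, w, h⟩ := h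
  refine ⟨fun r x => ∑ s : I × J, a x s.1 s.2 * u r s, fun r y => ∑ s : J × K, b y s.1 s.2 * v r s,
    fun r z => ∑ s : K × I, c z s.1 s.2 * w r s, fun x y z => ?_⟩
  have key : ∑ s : I × J, ∑ t : J × K, ∑ q : K × I,
      a x s.1 s.2 * b y t.1 t.2 * c z q.1 q.2 * matMulTensor I J K s t q =
      ∑ i, ∑ j, ∑ k, a x i j * b y j k * c z k i := by
    rw [Fintype.sum_prod_type]
    refine Finset.sum_congr rfl fun i _ => Finset.sum_congr rfl fun j _ => ?_
    rw [Fintype.sum_prod_type, Finset.sum_eq_single j]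
    · refine Finset.sum_congr rfl fun k _ => ?_
      rw [Finset.sum_eq_single (k, i)]
      · simp [matMulTensor]
      · rintro ⟨k', i'⟩ - hne
        have : ¬ (k = k' ∧ i' = i) := fun hh => hne (by rw [hh.1, hh.2])
        simp [matMulTensor, this]
      · simp
    · intro j' _ hne
      simp [matMulTensor, hne.symm]
    · simp
  refine key.symm.trans ?_
  simp only [h, Finset.mul_sum, Finset.sum_mul]
  calc _ = ∑ s : I × J, ∑ t : J × K, ∑ r, ∑ q : K × I,
        a x s.1 s.2 * b y t.1 t.2 * c z q.1 q.2 * (u r s * v r t * w r q) := by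
        refine Finset.sum_congr rfl fun s _ => Finset.sum_congr rfl fun t _ => Finset.sum_comm
    _ = ∑ s : I × J, ∑ r, ∑ t : J × K, ∑ q : K × I,
        a x s.1 s.2 * b y t.1 t.2 * c z q.1 q.2 * (u r s * v r t * w r q) := by
        refine Finset.sum_congr rfl fun s _ => Finset.sum_comm
    _ = ∑ r, ∑ s : I × J, ∑ t : J × K, ∑ q : K × I,
        a x s.1 s.2 * b y t.1 t.2 * c z q.1 q.2 * (u r s * v r t * w r q) := Finset.sum_comm
    _ = ∑ r, ∑ q : K × I, ∑ t : J × K, ∑ s : I × J,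
        a x s.1 s.2 * b y t.1 t.2 * c z q.1 q.2 * (u r s * v r t * w r q) := by
        refine Finset.sum_congr rfl fun r _ => ?_
        rw [Finset.sum_comm]
        conv_rhs => rw [Finset.sum_comm]
        refine Finset.sum_congr rfl fun s _ => Finset.sum_comm
    _ = _ := by
        refine Finset.sum_congr rfl fun r _ => Finset.sum_congr rfl fun q _ =>
          Finset.sum_congr rfl fun t _ => Finset.sum_congr rfl fun s _ => by ring

/-- The rank of the multiplication of `n × n` matrices is at least `n ^ 2`. -/
theorem TensorRankLE.sq_le {n R : ℕ} (h : TensorRankLE (matMulTensor (Fin n) (Fin n) (Fin n)) R) :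
    n ^ 2 ≤ R := by
  obtain ⟨u, v, w, h⟩ := h
  -- Setting the middle matrix to the identity turns tr (XYZ) into the nondegenerate pairing tr
  -- (XZ), so the identity of size n² factors through dimension R.
  let A : Matrix (Fin n × Fin n) (Fin R) ℂ := Matrix.of fun x r => u r x * ∑ j, v r (j, j)
  let W : Matrix (Fin R) (Fin n × Fin n) ℂ := Matrix.of fun r z => w r z.swap
  have hAW : A * W = 1 := by
    ext x z
    have : ∑ j, matMulTensor (Fin n) (Fin n) (Fin n) x (j, j) z.swap =
        (1 : Matrix (Fin n × Fin n) (Fin n × Fin n) ℂ) x z := by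
      rw [Finset.sum_eq_single x.2]
      · simp only [matMulTensor, Matrix.one_apply, Prod.ext_iff, Prod.fst_swap, Prod.snd_swap]
        congr 1
        exact propext ⟨fun hh => ⟨hh.2.2.symm, hh.2.1⟩, fun hh => ⟨trivial, hh.2, hh.1.symm⟩⟩
      · intro j _ hj
        simp [matMulTensor, hj.symm]
      · simp
    rw [← this]
    simp only [Matrix.mul_apply, A, W, Matrix.of_apply, h, Finset.mul_sum, Finset.sum_mul]
    rw [Finset.sum_comm]
  have h₁ : (A * W).rank ≤ A.rank := Matrix.rank_mul_le_left A W
  have h₂ : A.rank ≤ R := by simpa using A.rank_le_card_width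
  rw [hAW, Matrix.rank_one] at h₁
  simp only [Fintype.card_prod, Fintype.card_fin] at h₁
  nlinarith

end MatMulTensor

/-! ### From straight-line computations to tensor rank -/

open Polynomial in
/-- Along each line through the origin `f` is a polynomial, and its parts of degree `0`, `1`, `2`
are `c`, `l`, `q`. -/
def HasTwoJet {ι : Type} (f : (ι → ℂ) → ℂ) (c : ℂ) (l : (ι → ℂ) →ₗ[ℂ] ℂ) (q : (ι → ℂ) → ℂ) : Prop :=
  ∀ x : ι → ℂ, ∃ p : ℂ[X], (∀ t : ℂ, f (t • x) = p.eval t) ∧ p.coeff 0 = c ∧ p.coeff 1 = l x ∧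
    p.coeff 2 = q x

namespace HasTwoJet

variable {ι : Type} {f g : (ι → ℂ) → ℂ} {c d : ℂ} {l m : (ι → ℂ) →ₗ[ℂ] ℂ} {q s : (ι → ℂ) → ℂ}

theorem proj (i : ι) : HasTwoJet (fun x => x i) 0 (LinearMap.proj i) 0 := fun x =>
  ⟨.C (x i) * .X, fun t => by simp [mul_comm t], by simp, by simp, by simp⟩

theorem const (c : ℂ) : HasTwoJet (fun _ : ι → ℂ => c) c 0 0 := fun x =>
  ⟨.C c, fun t => by simp, by simp, by simp, by simp⟩

theorem add (hf : HasTwoJet f c l q) (hg : HasTwoJet g d m s) :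
    HasTwoJet (fun x => f x + g x) (c + d) (l + m) (q + s) := fun x => by
  obtain ⟨p, hp, h₀, h₁, h₂⟩ := hf x
  obtain ⟨r, hr, k₀, k₁, k₂⟩ := hg x
  exact ⟨p + r, fun t => by simp [hp, hr], by simp [h₀, k₀], by simp [h₁, k₁], by simp [h₂, k₂]⟩

theorem sub (hf : HasTwoJet f c l q) (hg : HasTwoJet g d m s) :
    HasTwoJet (fun x => f x - g x) (c - d) (l - m) (q - s) := fun x => by
  obtain ⟨p, hp, h₀, h₁, h₂⟩ := hf x
  obtain ⟨r, hr, k₀, k₁, k₂⟩ := hg x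
  exact ⟨p - r, fun t => by simp [hp, hr], by simp [h₀, k₀], by simp [h₁, k₁], by simp [h₂, k₂]⟩

/-- The term `l x * m x` is the only new quadratic contribution; the others rescale quadratic parts
already present. -/
theorem mul (hf : HasTwoJet f c l q) (hg : HasTwoJet g d m s) :
    HasTwoJet (fun x => f x * g x) (c * d) (c • m + d • l)
      (fun x => c * s x + l x * m x + d * q x) := fun x => by
  obtain ⟨p, hp, h₀, h₁, h₂⟩ := hf x
  obtain ⟨r, hr, k₀, k₁, k₂⟩ := hg x
  refine ⟨p * r, fun t => by simp [hp, hr], ?_, ?_, ?_⟩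
  · simp [Polynomial.mul_coeff_zero, h₀, k₀]
  · simp [Polynomial.mul_coeff_one, h₀, k₀, h₁, k₁]
    ring
  · simp [Polynomial.coeff_mul, Finset.Nat.antidiagonal_succ, h₀, k₀, h₁, k₁, h₂, k₂]
    ring

/-- A nowhere vanishing function with a two-jet is constant. -/
theorem eq_const_of_forall_ne_zero (hg : HasTwoJet g d m s) (h : ∀ x, g x ≠ 0) (x : ι → ℂ) :
    g x = d := by
  obtain ⟨r, hr, k₀, -, -⟩ := hg x
  -- Otherwise `r` has a complex root `t`, and `g` vanishes at `t • x`. This includes `r = 0`, of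
  -- degree `⊥`.
  have hdeg : r.degree = 0 := by
    by_contra hne
    obtain ⟨t, ht⟩ := IsAlgClosed.exists_root r hne
    exact h (t • x) ((hr t).trans ht)
  rw [Polynomial.eq_C_of_degree_eq_zero hdeg, k₀] at hr
  simpa using hr 1

/-- An admissible divisor is constant, so division is only a rescaling and creates no product of
linear forms. -/
theorem div (hf : HasTwoJet f c l q) (hg : HasTwoJet g d m s) (h : ∀ x, g x ≠ 0) :
    HasTwoJet (fun x => f x / g x) (d⁻¹ * c) (d⁻¹ • l) (d⁻¹ • q) := fun x => by
  obtain ⟨p, hp, h₀, h₁, h₂⟩ := hf x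
  refine ⟨.C d⁻¹ * p, fun t => ?_, by simp [h₀], by simp [h₁], by simp [h₂]⟩
  simp [hg.eq_const_of_forall_ne_zero h, hp, div_eq_inv_mul]

/-- A homogeneous function of degree two is its own degree two part. -/
theorem eq_of_homogeneous (hf : HasTwoJet f c l q) (h : ∀ (t : ℂ) x, f (t • x) = t ^ 2 * f x)
    (x : ι → ℂ) : f x = q x := by
  obtain ⟨p, hp, -, -, h₂⟩ := hf x
  have : p = .C (f x) * .X ^ 2 := Polynomial.funext fun t => by
    simp [← hp, h, mul_comm (t ^ 2)]
  rw [← h₂, this]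
  simp

end HasTwoJet

/-- The degree two parts of all functions available after `L` operations lie in the span of `L`
products of linear forms. -/
theorem StraightLine.exists_hasTwoJet {ι : Type} {L : ℕ} {S : Set ((ι → ℂ) → ℂ)}
    (h : StraightLine L S) : ∃ a b : Fin L → ((ι → ℂ) →ₗ[ℂ] ℂ), ∀ f ∈ S, ∃ c l, ∃ w : Fin L → ℂ,
      HasTwoJet f c l (fun x => ∑ r, w r * a r x * b r x) := by
  induction h with
  | start =>
    refine ⟨0, 0, ?_⟩
    rintro f (⟨i, rfl⟩ | ⟨c, rfl⟩)
    · exact ⟨0, LinearMap.proj i, 0, by simpa using! HasTwoJet.proj i⟩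
    · exact ⟨c, 0, 0, by simpa using! HasTwoJet.const c⟩
  | add _ hf hg ih =>
    obtain ⟨a, b, ih⟩ := ih
    -- A zero product fills the slot of an operation that adds nothing, keeping the number of
    -- products equal to the length.
    refine ⟨Fin.cons 0 a, Fin.cons 0 b, ?_⟩
    rintro e (rfl | he)
    · obtain ⟨c, l, w, hf⟩ := ih _ hf
      obtain ⟨d, m, v, hg⟩ := ih _ hg
      refine ⟨c + d, l + m, Fin.cons 0 (w + v), ?_⟩
      convert hf.add hg using 1
      ext x
      simp [Fin.sum_univ_succ, add_mul, Finset.sum_add_distrib]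
    · obtain ⟨c, l, w, he⟩ := ih _ he
      exact ⟨c, l, Fin.cons 0 w, by simpa [Fin.sum_univ_succ] using he⟩
  | sub _ hf hg ih =>
    obtain ⟨a, b, ih⟩ := ih
    refine ⟨Fin.cons 0 a, Fin.cons 0 b, ?_⟩
    rintro e (rfl | he)
    · obtain ⟨c, l, w, hf⟩ := ih _ hf
      obtain ⟨d, m, v, hg⟩ := ih _ hg
      refine ⟨c - d, l - m, Fin.cons 0 (w - v), ?_⟩
      convert hf.sub hg using 1
      ext x
      simp [Fin.sum_univ_succ, sub_mul, Finset.sum_sub_distrib]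
    · obtain ⟨c, l, w, he⟩ := ih _ he
      exact ⟨c, l, Fin.cons 0 w, by simpa [Fin.sum_univ_succ] using he⟩
  | mul _ hf hg ih =>
    obtain ⟨a, b, ih⟩ := ih
    obtain ⟨c, l, w, hf⟩ := ih _ hf
    obtain ⟨d, m, v, hg⟩ := ih _ hg
    -- The new slot holds the product of the linear parts of the two factors.
    refine ⟨Fin.cons l a, Fin.cons m b, ?_⟩
    rintro e (rfl | he)
    · refine ⟨c * d, c • m + d • l, Fin.cons 1 (c • v + d • w), ?_⟩
      convert hf.mul hg using 1
      ext x
      simp only [Fin.sum_univ_succ, Fin.cons_zero, Fin.cons_succ, Pi.add_apply, Pi.smul_apply,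
        smul_eq_mul, add_mul, Finset.sum_add_distrib, Finset.mul_sum, mul_assoc]
      ring
    · obtain ⟨c, l, w, he⟩ := ih _ he
      exact ⟨c, l, Fin.cons 0 w, by simpa [Fin.sum_univ_succ] using he⟩
  | div _ hf hg h0 ih =>
    obtain ⟨a, b, ih⟩ := ih
    refine ⟨Fin.cons 0 a, Fin.cons 0 b, ?_⟩
    rintro e (rfl | he)
    · obtain ⟨c, l, w, hf⟩ := ih _ hf
      obtain ⟨d, m, v, hg⟩ := ih _ hg
      refine ⟨d⁻¹ * c, d⁻¹ • l, Fin.cons 0 (d⁻¹ • w), ?_⟩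
      convert hf.div hg h0 using 1
      ext x
      simp [Fin.sum_univ_succ, Finset.mul_sum, mul_assoc]
    · obtain ⟨c, l, w, he⟩ := ih _ he
      exact ⟨c, l, Fin.cons 0 w, by simpa [Fin.sum_univ_succ] using he⟩

/-- Entries of the product are homogeneous of degree two, hence combinations of L products of linear
forms in both matrices together. Polarizing between left and right inputs splits each product a · b
into a(X) b(Y) + b(X) a(Y), which doubles L. -/
theorem MatMulInOps.tensorRankLE {n L : ℕ} (h : MatMulInOps n L) :
    TensorRankLE (matMulTensor (Fin n) (Fin n) (Fin n)) (L + L) := by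
  obtain ⟨S, hS, hmem⟩ := h
  obtain ⟨a, b, hab⟩ := hS.exists_hasTwoJet
  choose c l w hjet using fun i k => hab _ (hmem i k)
  have hq : ∀ i k x, (leftMatrix x * rightMatrix x) i k = ∑ r, w i k r * a r x * b r x :=
    fun i k => (hjet i k).eq_of_homogeneous fun t x => by
      simp only [Matrix.mul_apply, leftMatrix, rightMatrix, Matrix.of_apply, Pi.smul_apply,
        smul_eq_mul, Finset.mul_sum]
      exact Finset.sum_congr rfl fun j _ => by ring
  let X (s : Fin n × Fin n) : MatMulVars n → ℂ := Pi.single (Sum.inl s) 1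
  let Y (s : Fin n × Fin n) : MatMulVars n → ℂ := Pi.single (Sum.inr s) 1
  have key : TensorRankLE (matMulTensor (Fin n) (Fin n) (Fin n))
      (Fintype.card (Fin L ⊕ Fin L)) := by
    -- The output index is transposed because the tensor is in cyclic form.
    refine TensorRankLE.of_fintype (fun r x => Sum.elim (a · (X x)) (b · (X x)) r)
      (fun r y => Sum.elim (b · (Y y)) (a · (Y y)) r)
      (fun r z => Sum.elim (w z.2 z.1 ·) (w z.2 z.1 ·) r) fun x y z => ?_
    have hX := hq z.2 z.1 (X x)
    have hY := hq z.2 z.1 (Y y)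
    have hXY := hq z.2 z.1 (X x + Y y)
    have eX : (leftMatrix (X x) * rightMatrix (X x)) z.2 z.1 = 0 := by
      simp [Matrix.mul_apply, leftMatrix, rightMatrix, X]
    have eY : (leftMatrix (Y y) * rightMatrix (Y y)) z.2 z.1 = 0 := by
      simp [Matrix.mul_apply, leftMatrix, rightMatrix, Y]
    have eXY : (leftMatrix (X x + Y y) * rightMatrix (X x + Y y)) z.2 z.1 =
        matMulTensor (Fin n) (Fin n) (Fin n) x y z := by
      simp only [Matrix.mul_apply, leftMatrix, rightMatrix, X, Y, Matrix.of_apply, Pi.add_apply,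
        matMulTensor, Pi.single_apply, reduceCtorEq, if_false, add_zero, zero_add,
        Sum.inl.injEq, Sum.inr.injEq, mul_ite, mul_one, mul_zero, ← ite_and, Prod.ext_iff]
      rw [Finset.sum_eq_single x.2]
      · congr 1
        grind
      · intro j _ hj
        simp [hj]
      · simp
    rw [eX] at hX
    rw [eY] at hY
    rw [eXY] at hXY
    have expand : ∑ r, w z.2 z.1 r * a r (X x + Y y) * b r (X x + Y y) =
        ∑ r, w z.2 z.1 r * a r (X x) * b r (X x) + ∑ r, w z.2 z.1 r * a r (Y y) * b r (Y y) +
        ∑ r, (a r (X x) * b r (Y y) * w z.2 z.1 r + b r (X x) * a r (Y y) * w z.2 z.1 r) := by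
      rw [← Finset.sum_add_distrib, ← Finset.sum_add_distrib]
      refine Finset.sum_congr rfl fun r _ => ?_
      rw [map_add, map_add]
      ring
    rw [hXY, expand, ← hX, ← hY, Finset.sum_add_distrib, Fintype.sum_sum_type]
    simp
  simpa using key

/-! ### Building straight-line computations -/

section Cost

variable {ι : Type}

theorem StraightLine.const_mem {L : ℕ} {S : Set ((ι → ℂ) → ℂ)} (h : StraightLine L S) (c : ℂ) :
    (fun _ => c) ∈ S := by
  induction h with
  | start => exact Or.inr ⟨c, rfl⟩
  | add _ _ _ ih => exact Or.inr ih
  | sub _ _ _ ih => exact Or.inr ih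
  | mul _ _ _ ih => exact Or.inr ih
  | div _ _ _ _ ih => exact Or.inr ih

/-- Each computation in which the functions in `A` are available can be continued with `c`
operations so that the functions in `F` are available as well. -/
def CostLE (A F : Set ((ι → ℂ) → ℂ)) (c : ℕ) : Prop :=
  ∀ ⦃L S⦄, StraightLine L S → A ⊆ S → ∃ S', S ⊆ S' ∧ StraightLine (L + c) S' ∧ F ⊆ S'

namespace CostLE

variable {A B F F' : Set ((ι → ℂ) → ℂ)} {c c' : ℕ}

theorem refl (A : Set ((ι → ℂ) → ℂ)) : CostLE A A 0 := fun _ S hS hA => ⟨S, subset_rfl, hS, hA⟩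

theorem mono (h : CostLE A F c) (hA : A ⊆ B) (hF : F' ⊆ F) : CostLE B F' c := fun _ _ hS hB => by
  obtain ⟨S', h₁, h₂, h₃⟩ := h hS (hA.trans hB)
  exact ⟨S', h₁, h₂, hF.trans h₃⟩

theorem trans (h : CostLE A F c) (h' : CostLE (A ∪ F) F' c') :
    CostLE A (F ∪ F') (c + c') := fun L S hS hA => by
  obtain ⟨S₁, h₁, h₂, h₃⟩ := h hS hA
  obtain ⟨S₂, k₁, k₂, k₃⟩ := h' h₂ (Set.union_subset (hA.trans h₁) h₃)
  exact ⟨S₂, h₁.trans k₁, by rwa [← add_assoc], Set.union_subset (h₃.trans k₁) k₃⟩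

theorem biUnion {κ : Type*} {F : κ → Set ((ι → ℂ) → ℂ)} (s : Finset κ)
    (h : ∀ k ∈ s, CostLE A (F k) c) : CostLE A (⋃ k ∈ s, F k) (s.card * c) := by
  classical
  induction s using Finset.induction_on with
  | empty => simpa using (refl A).mono subset_rfl (Set.empty_subset A)
  | insert a s ha ih =>
    rw [Finset.card_insert_of_notMem ha, add_mul, one_mul, Finset.set_biUnion_insert,
      Set.union_comm]
    exact (ih fun k hk => h k (Finset.mem_insert_of_mem hk)).trans
      ((h a (Finset.mem_insert_self a s)).mono Set.subset_union_left subset_rfl)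

theorem iUnion {κ : Type*} [Fintype κ] {F : κ → Set ((ι → ℂ) → ℂ)}
    (h : ∀ k, CostLE A (F k) c) : CostLE A (⋃ k, F k) (Fintype.card κ * c) := by
  simpa using biUnion Finset.univ fun k _ => h k

theorem range {κ : Type*} [Fintype κ] {F : κ → (ι → ℂ) → ℂ}
    (h : ∀ k, CostLE A {F k} c) : CostLE A (Set.range F) (Fintype.card κ * c) :=
  (iUnion h).mono subset_rfl (Set.range_subset_iff.2 fun k => Set.mem_iUnion.2 ⟨k, rfl⟩)

/-- Each term costs one multiplication and one addition, starting from the free constant zero. -/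
theorem linearCombination {κ : Type*} (s : Finset κ) (w : κ → ℂ) (f : κ → (ι → ℂ) → ℂ)
    (hf : ∀ k ∈ s, f k ∈ A) : CostLE A {fun x => ∑ k ∈ s, w k * f k x} (s.card * 2) := by
  classical
  induction s using Finset.induction_on with
  | empty => exact fun L S hS _ => ⟨S, subset_rfl, hS, by simpa using hS.const_mem 0⟩
  | insert a s ha ih =>
    intro L S hS hA
    obtain ⟨S', h₁, h₂, h₃⟩ := ih (fun k hk => hf k (Finset.mem_insert_of_mem hk)) hS hA
    have hmul := h₂.mul (h₂.const_mem (w a)) (h₁ (hA (hf a (Finset.mem_insert_self a s))))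
    have hadd := hmul.add (Set.mem_insert _ _) (Set.mem_insert_of_mem _ (h₃ rfl))
    have hcard : L + s.card * 2 + 1 + 1 = L + (insert a s).card * 2 := by
      rw [Finset.card_insert_of_notMem ha]
      ring
    refine ⟨_, ?_, hcard ▸ hadd, ?_⟩
    · exact (h₁.trans (Set.subset_insert _ _)).trans (Set.subset_insert _ _)
    · rw [Set.singleton_subset_iff]
      left
      ext x
      rw [Finset.sum_insert ha]

end CostLE

/-- Substitution of available functions for the inputs of a computation. -/
theorem StraightLine.substitute {κ : Type} {L : ℕ} {S : Set ((κ → ℂ) → ℂ)} (h : StraightLine L S)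
    (σ : κ → (ι → ℂ) → ℂ) : CostLE (Set.range σ) ((fun f x => f fun k => σ k x) '' S) L := by
  intro L₀ S₀ h₀ hσ
  simp only [Set.image_subset_iff]
  induction h with
  | start =>
    refine ⟨S₀, subset_rfl, h₀, ?_⟩
    rintro f (⟨i, rfl⟩ | ⟨c, rfl⟩)
    · exact hσ ⟨i, rfl⟩
    · exact h₀.const_mem c
  | add _ hf hg ih =>
    obtain ⟨S', h₁, h₂, h₃⟩ := ih
    exact ⟨_, h₁.trans (Set.subset_insert _ _), h₂.add (h₃ hf) (h₃ hg),
      Set.insert_subset (Or.inl rfl) fun f hf => Or.inr (h₃ hf)⟩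
  | sub _ hf hg ih =>
    obtain ⟨S', h₁, h₂, h₃⟩ := ih
    exact ⟨_, h₁.trans (Set.subset_insert _ _), h₂.sub (h₃ hf) (h₃ hg),
      Set.insert_subset (Or.inl rfl) fun f hf => Or.inr (h₃ hf)⟩
  | mul _ hf hg ih =>
    obtain ⟨S', h₁, h₂, h₃⟩ := ih
    exact ⟨_, h₁.trans (Set.subset_insert _ _), h₂.mul (h₃ hf) (h₃ hg),
      Set.insert_subset (Or.inl rfl) fun f hf => Or.inr (h₃ hf)⟩
  | div _ hf hg hne ih =>
    obtain ⟨S', h₁, h₂, h₃⟩ := ih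
    exact ⟨_, h₁.trans (Set.subset_insert _ _), h₂.div (h₃ hf) (h₃ hg) fun x => hne _,
      Set.insert_subset (Or.inl rfl) fun f hf => Or.inr (h₃ hf)⟩

/-- The entries of a matrix of functions. -/
def entrySet {I J : Type*} (a : I → J → (ι → ℂ) → ℂ) : Set ((ι → ℂ) → ℂ) :=
  Set.range fun s : I × J => a s.1 s.2

theorem mem_entrySet {I J : Type*} (a : I → J → (ι → ℂ) → ℂ) (i : I) (j : J) :
    a i j ∈ entrySet a := ⟨(i, j), rfl⟩

theorem MatMulInOps.costLE {n L : ℕ} (h : MatMulInOps n L) (a b : Fin n → Fin n → (ι → ℂ) → ℂ) :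
    CostLE (entrySet a ∪ entrySet b) (entrySet fun i k x => ∑ j, a i j x * b j k x) L := by
  obtain ⟨S, hS, hmem⟩ := h
  refine (hS.substitute (Sum.elim (fun s => a s.1 s.2) fun s => b s.1 s.2)).mono ?_ ?_
  · rw [Set.Sum.elim_range]
    rfl
  · rintro _ ⟨⟨i, k⟩, rfl⟩
    exact ⟨_, hmem i k, by simp [Matrix.mul_apply, leftMatrix, rightMatrix]⟩

theorem MatMulInOps.of_costLE {n L : ℕ} (h : CostLE
    (entrySet (fun i j (x : MatMulVars n → ℂ) => leftMatrix x i j) ∪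
      entrySet (fun i j (x : MatMulVars n → ℂ) => rightMatrix x i j))
    (entrySet fun i k (x : MatMulVars n → ℂ) => ∑ j, leftMatrix x i j * rightMatrix x j k) L) :
    MatMulInOps n L := by
  obtain ⟨S, -, hS, hF⟩ := h (L := 0) .start (by
    rintro _ (⟨s, rfl⟩ | ⟨s, rfl⟩)
    · exact Or.inl ⟨Sum.inl s, rfl⟩
    · exact Or.inl ⟨Sum.inr s, rfl⟩)
  rw [zero_add] at hS
  exact ⟨S, hS, fun i k => hF ⟨(i, k), by simp [Matrix.mul_apply]⟩⟩

end Cost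

/-! ### Padding and block recursion -/

/-- Padding with zeros. -/
theorem MatMulInOps.of_le {n m L : ℕ} (h : MatMulInOps m L) (hnm : n ≤ m) : MatMulInOps n L := by
  refine .of_costLE fun L₀ S hS hA => ?_
  let a : Fin m → Fin m → (MatMulVars n → ℂ) → ℂ := fun i j x =>
    if hij : i.1 < n ∧ j.1 < n then leftMatrix x ⟨i, hij.1⟩ ⟨j, hij.2⟩ else 0
  let b : Fin m → Fin m → (MatMulVars n → ℂ) → ℂ := fun i j x =>
    if hij : i.1 < n ∧ j.1 < n then rightMatrix x ⟨i, hij.1⟩ ⟨j, hij.2⟩ else 0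
  obtain ⟨S', h₁, h₂, h₃⟩ := h.costLE a b hS (by
    rintro _ (⟨⟨i, j⟩, rfl⟩ | ⟨⟨i, j⟩, rfl⟩)
    · by_cases hij : i.1 < n ∧ j.1 < n
      · simpa only [a, hij, and_self, dif_pos] using hA (Or.inl (mem_entrySet _ _ _))
      · simpa only [a, hij, dif_neg, not_false_eq_true] using hS.const_mem 0
    · by_cases hij : i.1 < n ∧ j.1 < n
      · simpa only [b, hij, and_self, dif_pos] using hA (Or.inr (mem_entrySet _ _ _))
      · simpa only [b, hij, dif_neg, not_false_eq_true] using hS.const_mem 0)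
  refine ⟨S', h₁, h₂, ?_⟩
  rintro _ ⟨⟨i, k⟩, rfl⟩
  have := h₃ (mem_entrySet _ (Fin.castLE hnm i) (Fin.castLE hnm k))
  convert this using 1
  ext x
  refine Finset.sum_of_injOn (Fin.castLE hnm) ((Fin.castLE_injective hnm).injOn) (by simp) ?_ ?_
  · intro j _ hj
    have : ¬ j.1 < n := fun hjn => hj ⟨⟨j, hjn⟩, by simp, rfl⟩
    simp [a, this]
  · intro j _
    simp [a, b]

theorem matMulInOps_one : MatMulInOps 1 1 := by
  refine ⟨_, StraightLine.mul .start (Or.inl ⟨Sum.inl (0, 0), rfl⟩)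
    (Or.inl ⟨Sum.inr (0, 0), rfl⟩), fun i j => Or.inl ?_⟩
  ext x
  simp [Matrix.mul_apply, leftMatrix, rightMatrix, Subsingleton.elim i 0, Subsingleton.elim j 0]

/-- One level of block recursion with a bilinear algorithm of rank `R`. -/
theorem MatMulInOps.mul_of_tensorRankLE {N M L R : ℕ}
    (hR : TensorRankLE (matMulTensor (Fin N) (Fin N) (Fin N)) R) (h : MatMulInOps M L) :
    MatMulInOps (N * M) (R * L + 6 * R * N ^ 2 * M ^ 2) := by
  obtain ⟨u, v, w, hT⟩ := hR
  refine .of_costLE ?_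
  let e : Fin N × Fin M ≃ Fin (N * M) := finProdFinEquiv
  let a : Fin (N * M) → Fin (N * M) → (MatMulVars (N * M) → ℂ) → ℂ := fun i j x => leftMatrix x i j
  let b : Fin (N * M) → Fin (N * M) → (MatMulVars (N * M) → ℂ) → ℂ := fun i j x => rightMatrix x i j
  -- The indices `s` run over blocks and `p`, `q` over positions inside a block: `U` and `V` are the
  -- linear forms in blocks, `P` the R recursive block products, and `W` their recombination.
  let U : Fin R → Fin M → Fin M → (MatMulVars (N * M) → ℂ) → ℂ := fun r p q x =>
    ∑ s : Fin N × Fin N, u r s * a (e (s.1, p)) (e (s.2, q)) x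
  let V : Fin R → Fin M → Fin M → (MatMulVars (N * M) → ℂ) → ℂ := fun r p q x =>
    ∑ s : Fin N × Fin N, v r s * b (e (s.1, p)) (e (s.2, q)) x
  let P : Fin R → Fin M → Fin M → (MatMulVars (N * M) → ℂ) → ℂ := fun r p q x =>
    ∑ t, U r p t x * V r t q x
  let W : (Fin N × Fin N) × (Fin M × Fin M) → (MatMulVars (N * M) → ℂ) → ℂ := fun s x =>
    ∑ r, w r (s.1.2, s.1.1) * P r s.2.1 s.2.2 x
  have hU : CostLE (entrySet a ∪ entrySet b)
      (Set.range fun s : Fin R × Fin M × Fin M => U s.1 s.2.1 s.2.2) _ :=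
    CostLE.range fun s => .linearCombination Finset.univ _ _
      fun k _ => Or.inl (mem_entrySet _ _ _)
  have hV : CostLE (entrySet a ∪ entrySet b)
      (Set.range fun s : Fin R × Fin M × Fin M => V s.1 s.2.1 s.2.2) _ :=
    CostLE.range fun s => .linearCombination Finset.univ _ _
      fun k _ => Or.inr (mem_entrySet _ _ _)
  have hP := CostLE.iUnion fun r => (h.costLE (U r) (V r)).mono
    (B := ⋃ r, (entrySet (U r) ∪ entrySet (V r)))
    (Set.subset_iUnion (fun r => entrySet (U r) ∪ entrySet (V r)) r) subset_rfl
  have hW : CostLE (⋃ r, entrySet (P r)) (Set.range W) _ :=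
    CostLE.range fun s => .linearCombination Finset.univ _ _
      fun r _ => Set.mem_iUnion.2 ⟨r, mem_entrySet _ _ _⟩
  have hUV := hU.trans (hV.mono Set.subset_union_left subset_rfl)
  have hUVP := hUV.trans (hP.mono (F' := ⋃ r, entrySet (P r)) (by
    refine Set.iUnion_subset fun r => Set.union_subset ?_ ?_
    · rintro _ ⟨s, rfl⟩
      exact Or.inr (Or.inl ⟨(r, s), rfl⟩)
    · rintro _ ⟨s, rfl⟩
      exact Or.inr (Or.inr ⟨(r, s), rfl⟩)) subset_rfl)
  have hall := hUVP.trans (hW.mono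
    (Set.subset_union_right.trans Set.subset_union_right) subset_rfl)
  -- `U`, `V` and `W` each need R N² M² terms at two operations per term, whence the 6.
  have hcost : Fintype.card (Fin R × Fin M × Fin M) * ((Finset.univ : Finset (Fin N × Fin N)).card * 2) +
      Fintype.card (Fin R × Fin M × Fin M) * ((Finset.univ : Finset (Fin N × Fin N)).card * 2) +
      Fintype.card (Fin R) * L + Fintype.card ((Fin N × Fin N) × (Fin M × Fin M)) *
      ((Finset.univ : Finset (Fin R)).card * 2) = R * L + 6 * R * N ^ 2 * M ^ 2 := by
    simp only [Fintype.card_prod, Fintype.card_fin, Finset.card_univ]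
    ring
  rw [hcost] at hall
  refine hall.mono subset_rfl ?_
  rintro _ ⟨⟨i, k⟩, rfl⟩
  obtain ⟨⟨i, p⟩, rfl⟩ := e.surjective i
  obtain ⟨⟨k, q⟩, rfl⟩ := e.surjective k
  refine Or.inr ⟨((i, k), (p, q)), ?_⟩
  ext x
  have expand : W ((i, k), (p, q)) x = ∑ t, ∑ s : Fin N × Fin N, ∑ s' : Fin N × Fin N,
      matMulTensor (Fin N) (Fin N) (Fin N) s s' (k, i) *
        (a (e (s.1, p)) (e (s.2, t)) x * b (e (s'.1, t)) (e (s'.2, q)) x) := by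
    simp only [W, P, U, V, hT, Finset.mul_sum, Finset.sum_mul]
    rw [Finset.sum_comm]
    refine Finset.sum_congr rfl fun t _ => ?_
    rw [Finset.sum_comm]
    conv_rhs => rw [Finset.sum_comm]
    refine Finset.sum_congr rfl fun s _ => ?_
    rw [Finset.sum_comm]
    exact Finset.sum_congr rfl fun s' _ => Finset.sum_congr rfl fun r _ => by ring
  have hdelta : ∀ t, ∑ s : Fin N × Fin N, ∑ s' : Fin N × Fin N,
      matMulTensor (Fin N) (Fin N) (Fin N) s s' (k, i) *
        (a (e (s.1, p)) (e (s.2, t)) x * b (e (s'.1, t)) (e (s'.2, q)) x) =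
      ∑ j, a (e (i, p)) (e (j, t)) x * b (e (j, t)) (e (k, q)) x := by
    intro t
    rw [Fintype.sum_prod_type, Finset.sum_eq_single i]
    · refine Finset.sum_congr rfl fun j _ => ?_
      rw [Finset.sum_eq_single (j, k)]
      · simp [matMulTensor]
      · rintro ⟨j', k'⟩ - hne
        have : ¬ (j = j' ∧ k' = k) := fun hh => hne (by rw [hh.1, hh.2])
        simp [matMulTensor, this]
      · simp
    · intro i' _ hne
      refine Finset.sum_eq_zero fun j _ => Finset.sum_eq_zero fun s' _ => ?_
      simp [matMulTensor, hne.symm]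
    · simp
  rw [expand]
  simp only [hdelta]
  rw [Finset.sum_comm, ← Fintype.sum_prod_type', ← e.sum_comp]

/-- Since N² ≤ R, the linear overhead on each level is at most 6 N² times the current power of R;
summing over levels costs only a factor linear in `k`. -/
theorem MatMulInOps.pow_of_tensorRankLE {N R : ℕ}
    (hR : TensorRankLE (matMulTensor (Fin N) (Fin N) (Fin N)) R) (k : ℕ) :
    ∃ L ≤ (1 + 6 * N ^ 2 * k) * R ^ k, MatMulInOps (N ^ k) L := by
  induction k with
  | zero => exact ⟨1, by simp, by simpa using matMulInOps_one⟩
  | succ k ih =>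
    obtain ⟨L, hL, h⟩ := ih
    refine ⟨_, ?_, pow_succ' N k ▸ MatMulInOps.mul_of_tensorRankLE hR h⟩
    have hpow : (N ^ k) ^ 2 ≤ R ^ k := by
      rw [← pow_mul, mul_comm, pow_mul]
      exact Nat.pow_le_pow_left hR.sq_le k
    calc R * L + 6 * R * N ^ 2 * (N ^ k) ^ 2
        ≤ R * ((1 + 6 * N ^ 2 * k) * R ^ k) + 6 * R * N ^ 2 * R ^ k := by gcongr
      _ = (1 + 6 * N ^ 2 * (k + 1)) * R ^ (k + 1) := by ring

/-! ### The exponent of matrix multiplication and tensor rank -/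

/-- The real numbers of which `matMulExponent` is the infimum. -/
def matMulExponentSet : Set ℝ :=
  {w : ℝ | ∀ ε : ℝ, 0 < ε → ∃ C : ℝ, ∀ n : ℕ, 0 < n →
    ∃ L : ℕ, (L : ℝ) ≤ C * (n : ℝ) ^ (w + ε) ∧ MatMulInOps n L}

/-- Rank at least n² and at most 2L forces L ≥ n²/2. This also makes the infimum defining ω a
genuine one. -/
theorem two_le_of_mem_matMulExponentSet {w : ℝ} (hw : w ∈ matMulExponentSet) : 2 ≤ w := by
  by_contra! hlt
  -- Half the gap: the operation bound then still falls short of n² by an unbounded power of n.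
  obtain ⟨C, hC⟩ := hw ((2 - w) / 2) (by linarith)
  have hbound : ∀ n : ℕ, 0 < n → (n : ℝ) ^ ((2 - w) / 2) ≤ 2 * C := by
    intro n hn
    obtain ⟨L, hL, h⟩ := hC n hn
    have hn' : (0 : ℝ) < n := by exact_mod_cast hn
    have hsq : (n : ℝ) ^ 2 ≤ L + L := by exact_mod_cast h.tensorRankLE.sq_le
    have hpos := Real.rpow_pos_of_pos hn' (w + (2 - w) / 2)
    have hsplit : (n : ℝ) ^ ((2 - w) / 2) * (n : ℝ) ^ (w + (2 - w) / 2) = (n : ℝ) ^ 2 := by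
      rw [← Real.rpow_add hn', ← Real.rpow_natCast]
      congr 1
      push_cast
      ring
    refine le_of_mul_le_mul_right ?_ hpos
    rw [hsplit]
    linarith
  have htend : Filter.Tendsto (fun n : ℕ => (n : ℝ) ^ ((2 - w) / 2)) Filter.atTop Filter.atTop :=
    (tendsto_rpow_atTop (by linarith)).comp tendsto_natCast_atTop_atTop
  obtain ⟨n, hn, hn'⟩ := ((htend.eventually_gt_atTop (2 * C)).and
    (Filter.eventually_gt_atTop 0)).exists
  exact (hbound n hn').not_gt hn

/-- Pad `n` to the power N^k with k = ⌈log_N n⌉ and recurse `k` times: the cost is R^k = (N^k)^τ up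
to a factor linear in k. -/
theorem logb_mem_matMulExponentSet {N R : ℕ} (hN : 2 ≤ N)
    (hR : TensorRankLE (matMulTensor (Fin N) (Fin N) (Fin N)) R) :
    Real.logb N R ∈ matMulExponentSet := by
  intro ε hε
  set τ := Real.logb N R with hτ
  have hN₀ : (0 : ℝ) < N := by positivity
  have hN₁ : (1 : ℝ) < N := by exact_mod_cast hN
  have hR₁ : 1 ≤ R := (Nat.one_le_pow 2 N (by omega)).trans hR.sq_le
  have hR₀ : (0 : ℝ) < R := by exact_mod_cast hR₁
  have hNτ : (N : ℝ) ^ τ = R := Real.rpow_logb hN₀ hN₁.ne' hR₀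
  have hτ₀ : 0 ≤ τ := Real.logb_nonneg hN₁ (by exact_mod_cast hR₁)
  have hlogN : 0 < Real.log N := Real.log_pos hN₁
  -- the factor linear in the recursion depth is absorbed by `N ^ (k * ε)`
  set D : ℝ := 1 + 6 * N ^ 2 / (ε * Real.log N) with hD
  have hdepth : ∀ k : ℕ, (1 + 6 * N ^ 2 * k : ℝ) ≤ D * ((N : ℝ) ^ k) ^ ε := by
    intro k
    have h₁ : (1 : ℝ) ≤ ((N : ℝ) ^ k) ^ ε := Real.one_le_rpow (one_le_pow₀ hN₁.le) hε.le
    have h₂ : (k : ℝ) * Real.log N ≤ ((N : ℝ) ^ k) ^ ε / ε := by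
      rw [← Real.log_pow]
      exact Real.log_le_rpow_div (by positivity) hε
    have h₃ : (k : ℝ) ≤ ((N : ℝ) ^ k) ^ ε / (ε * Real.log N) := by
      rw [le_div_iff₀ (by positivity)]
      rw [le_div_iff₀ hε] at h₂
      linarith
    calc (1 + 6 * N ^ 2 * k : ℝ)
        ≤ ((N : ℝ) ^ k) ^ ε + 6 * N ^ 2 * (((N : ℝ) ^ k) ^ ε / (ε * Real.log N)) := by gcongr
      _ = D * ((N : ℝ) ^ k) ^ ε := by rw [hD]; ring
  have hD₀ : 0 ≤ D := by positivity
  -- Padding enlarges `n` by at most a factor N, which contributes N ^ (τ + ε).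
  refine ⟨D * (N : ℝ) ^ (τ + ε), fun n hn => ?_⟩
  have hn₀ : (0 : ℝ) ≤ n := n.cast_nonneg
  obtain ⟨L, hL, h⟩ := MatMulInOps.pow_of_tensorRankLE hR (Nat.clog N n)
  refine ⟨L, ?_, h.of_le (Nat.le_pow_clog hN n)⟩
  have hpow : (N : ℝ) ^ Nat.clog N n ≤ N * n := by
    have : N ^ Nat.clog N n ≤ N * n := by
      rcases Nat.lt_or_ge 1 n with h1 | h1
      · have hlt := (Nat.pow_pred_clog_lt_self hN h1).le
        have hc := Nat.clog_pos hN h1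
        calc N ^ Nat.clog N n = N * N ^ (Nat.clog N n).pred := by
              rw [← pow_succ', ← Nat.succ_eq_add_one, Nat.succ_pred_eq_of_pos hc]
          _ ≤ N * n := Nat.mul_le_mul_left N hlt
      · rw [Nat.clog_of_right_le_one h1, pow_zero]
        exact Nat.one_le_iff_ne_zero.2 (by positivity)
    exact_mod_cast this
  have hRk : (R : ℝ) ^ Nat.clog N n = ((N : ℝ) ^ Nat.clog N n) ^ τ := by
    rw [← hNτ, ← Real.rpow_natCast, ← Real.rpow_natCast, ← Real.rpow_mul hN₀.le,
      ← Real.rpow_mul hN₀.le, mul_comm]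
  calc (L : ℝ) ≤ (1 + 6 * N ^ 2 * Nat.clog N n) * R ^ Nat.clog N n := by exact_mod_cast hL
    _ ≤ D * ((N : ℝ) ^ Nat.clog N n) ^ ε * R ^ Nat.clog N n := by gcongr; exact hdepth _
    _ = D * ((N : ℝ) ^ Nat.clog N n) ^ (τ + ε) := by
      rw [hRk, Real.rpow_add (by positivity)]
      ring
    _ ≤ D * (N * n) ^ (τ + ε) := by gcongr
    _ = D * (N : ℝ) ^ (τ + ε) * (n : ℝ) ^ (τ + ε) := by
      rw [Real.mul_rpow hN₀.le hn₀]
      ring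

theorem bddBelow_matMulExponentSet : BddBelow matMulExponentSet :=
  ⟨2, fun _ => two_le_of_mem_matMulExponentSet⟩

/-- The schoolbook algorithm for 2 × 2 matrices, with eight products, suffices. -/
theorem matMulExponentSet_nonempty : matMulExponentSet.Nonempty := by
  refine ⟨_, logb_mem_matMulExponentSet (N := 2) le_rfl (R := Fintype.card (Fin 2 × Fin 2 × Fin 2)) ?_⟩
  refine TensorRankLE.of_fintype (fun r x => if x = (r.1, r.2.1) then 1 else 0)
    (fun r y => if y = (r.2.1, r.2.2) then 1 else 0)
    (fun r z => if z = (r.2.2, r.1) then 1 else 0) fun x y z => ?_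
  rw [Finset.sum_eq_single (x.1, x.2, y.2)]
  · simp only [matMulTensor, Prod.ext_iff]
    grind
  · rintro ⟨i, j, k⟩ - hne
    simp only [Prod.ext_iff, ne_eq] at hne ⊢
    grind
  · simp

theorem two_le_matMulExponent : 2 ≤ matMulExponent :=
  le_csInf matMulExponentSet_nonempty fun _ => two_le_of_mem_matMulExponentSet

/-- The infimum in the definition of `matMulExponent` is attained. -/
theorem matMulExponent_mem : matMulExponent ∈ matMulExponentSet := by
  intro ε hε
  obtain ⟨w, hw, hlt⟩ := exists_lt_of_csInf_lt matMulExponentSet_nonempty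
    (show sInf matMulExponentSet < matMulExponent + ε / 2 from lt_add_of_pos_right _ (by positivity))
  obtain ⟨C, hC⟩ := hw (ε / 2) (by positivity)
  -- The case n = 1 shows this; it is needed to enlarge the exponent under the constant.
  have hC₀ : 0 ≤ C := by
    obtain ⟨L, hL, -⟩ := hC 1 one_pos
    simpa using (Nat.cast_nonneg L).trans hL
  refine ⟨C, fun n hn => ?_⟩
  obtain ⟨L, hL, h⟩ := hC n hn
  refine ⟨L, hL.trans ?_, h⟩
  have : (1 : ℝ) ≤ n := by exact_mod_cast hn
  exact mul_le_mul_of_nonneg_left (Real.rpow_le_rpow_of_exponent_le this (by linarith)) hC₀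

/-- Upper bounds on the rank of square matrix multiplication from the exponent. -/
theorem exists_tensorRankLE_rpow {ε : ℝ} (hε : 0 < ε) : ∃ C : ℝ, ∀ n : ℕ, 0 < n →
    ∃ R : ℕ, (R : ℝ) ≤ C * (n : ℝ) ^ (matMulExponent + ε) ∧
      TensorRankLE (matMulTensor (Fin n) (Fin n) (Fin n)) R := by
  obtain ⟨C, hC⟩ := matMulExponent_mem ε hε
  refine ⟨2 * C, fun n hn => ?_⟩
  obtain ⟨L, hL, h⟩ := hC n hn
  refine ⟨L + L, ?_, h.tensorRankLE⟩
  push_cast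
  linarith

/-- Lower bounds on the rank of rectangular matrix multiplication from the exponent. -/
theorem TensorRankLE.rpow_matMulExponent_le {I J K : Type*} [DecidableEq I] [DecidableEq J]
    [DecidableEq K] [Fintype I] [Fintype J] [Fintype K] {R : ℕ}
    (h : TensorRankLE (matMulTensor I J K) R)
    (hN : 2 ≤ Fintype.card I * Fintype.card J * Fintype.card K) :
    ((Fintype.card I * Fintype.card J * Fintype.card K : ℕ) : ℝ) ^ matMulExponent ≤
      (R : ℝ) ^ 3 := by
  have hsq := h.matMulTensor_square
  set N := Fintype.card I * Fintype.card J * Fintype.card K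
  have hN₁ : (1 : ℝ) < N := by exact_mod_cast hN
  have hR₁ : 1 ≤ R ^ 3 := (Nat.one_le_pow 2 N (by omega)).trans hsq.sq_le
  have hle : matMulExponent ≤ Real.logb N (R ^ 3 : ℕ) :=
    csInf_le bddBelow_matMulExponentSet (logb_mem_matMulExponentSet hN hsq)
  calc (N : ℝ) ^ matMulExponent ≤ (N : ℝ) ^ Real.logb N (R ^ 3 : ℕ) :=
        Real.rpow_le_rpow_of_exponent_le hN₁.le hle
    _ = ((R ^ 3 : ℕ) : ℝ) :=
        Real.rpow_logb (by positivity) hN₁.ne' (by exact_mod_cast hR₁)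
    _ = (R : ℝ) ^ 3 := by push_cast; rfl

/-! ### The group algebra tensor -/

open Classical in
/-- The structure tensor of the group algebra, in its cyclically symmetric form. -/
def groupTensor (G : Type*) [Group G] : G → G → G → ℂ := fun a b c => if a * b * c = 1 then 1 else 0

section GroupTensor

variable {G : Type*} [Group G]

/-- Conjugation by `i'` regroups the product into the right quotients i' i⁻¹, j j'⁻¹, k k'⁻¹, to
which the triple product property applies. -/
theorem TripleProductProperty.eq_one_iff {S₁ S₂ S₃ : Finset G}
    (h : TripleProductProperty S₁ S₂ S₃) (i i' : S₁) (j j' : S₂) (k k' : S₃) :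
    ((i : G)⁻¹ * j) * ((j' : G)⁻¹ * k) * ((k' : G)⁻¹ * i') = 1 ↔ j = j' ∧ k = k' ∧ i' = i := by
  constructor
  · intro heq
    obtain ⟨h₁, h₂, h₃⟩ := h (i' * (i : G)⁻¹) ⟨i', i'.2, i, i.2, rfl⟩ (j * (j' : G)⁻¹) ⟨j, j.2, j', j'.2, rfl⟩
      (k * (k' : G)⁻¹) ⟨k, k.2, k', k'.2, rfl⟩ (by
        calc (i' * (i : G)⁻¹) * (j * (j' : G)⁻¹) * (k * (k' : G)⁻¹)
            = i' * (((i : G)⁻¹ * j) * ((j' : G)⁻¹ * k) * ((k' : G)⁻¹ * i')) * (i' : G)⁻¹ := by group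
          _ = 1 := by rw [heq]; group)
    exact ⟨Subtype.ext (mul_inv_eq_one.1 h₂), Subtype.ext (mul_inv_eq_one.1 h₃),
      Subtype.ext (mul_inv_eq_one.1 h₁)⟩
  · rintro ⟨rfl, rfl, rfl⟩
    group

/-- Three subsets with the triple product property embed powers of a matrix multiplication tensor
into powers of the group algebra tensor. -/
theorem TripleProductProperty.tensorRankLE [DecidableEq G] {S₁ S₂ S₃ : Finset G}
    (h : TripleProductProperty S₁ S₂ S₃) {l R : ℕ}
    (hR : TensorRankLE (fun a b c : Fin l → G => ∏ t, groupTensor G (a t) (b t) (c t)) R) :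
    TensorRankLE (matMulTensor (Fin l → S₁) (Fin l → S₂) (Fin l → S₃)) R := by
  convert hR.comap (fun (x : (Fin l → S₁) × (Fin l → S₂)) t => ((x.1 t : G)⁻¹ * x.2 t))
    (fun (x : (Fin l → S₂) × (Fin l → S₃)) t => ((x.1 t : G)⁻¹ * x.2 t))
    (fun (x : (Fin l → S₃) × (Fin l → S₁)) t => ((x.1 t : G)⁻¹ * x.2 t)) using 4 with x y z
  simp only [matMulTensor, groupTensor, h.eq_one_iff, funext_iff]
  rw [Fintype.prod_ite_zero]
  simp only [forall_and, Finset.prod_const_one]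

/-- A decomposition of `ℂ[G]` into matrix algebras decomposes its tensor into matrix multiplication
tensors. -/
theorem exists_groupTensor_eq_sum {k : ℕ} {d : Fin k → ℕ}
    (e : MonoidAlgebra ℂ G ≃ₐ[ℂ] ((i : Fin k) → Matrix (Fin (d i)) (Fin (d i)) ℂ)) :
    ∃ A B C : (i : Fin k) → G → Fin (d i) → Fin (d i) → ℂ, ∀ a b c, groupTensor G a b c =
      ∑ i, ∑ p, ∑ q, ∑ r, A i a p q * B i b q r * C i c r p := by
  classical
  let X : G → (i : Fin k) → Matrix (Fin (d i)) (Fin (d i)) ℂ := fun a => e (MonoidAlgebra.single a 1)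
  -- The coefficient at 1, transported to the matrix algebras. Only its linearity matters: its
  -- values on matrix units are absorbed into the third factor, so it need not be identified as a
  -- combination of traces.
  let φ : ((i : Fin k) → Matrix (Fin (d i)) (Fin (d i)) ℂ) →ₗ[ℂ] ℂ :=
    { toFun := fun Y => (e.symm Y).coeff 1
      map_add' := fun Y Z => by simp
      map_smul' := fun c Y => by simp }
  have hφ : ∀ Y, φ Y = ∑ i, ∑ p, ∑ s, Y i p s * φ (Pi.single i (Matrix.single p s 1)) := by
    intro Y
    conv_lhs => rw [← Finset.univ_sum_single Y]
    rw [map_sum]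
    refine Finset.sum_congr rfl fun i _ => ?_
    conv_lhs => rw [Matrix.matrix_eq_sum_single (Y i)]
    have := map_sum (φ ∘ₗ LinearMap.single ℂ (fun i => Matrix (Fin (d i)) (Fin (d i)) ℂ) i)
      (fun p => ∑ s, Matrix.single p s (Y i p s)) Finset.univ
    refine this.trans (Finset.sum_congr rfl fun p _ => ?_)
    rw [map_sum]
    refine Finset.sum_congr rfl fun s _ => ?_
    have hs : Matrix.single p s (Y i p s) = Y i p s • Matrix.single p s (1 : ℂ) := by simp
    rw [hs, map_smul]
    rfl
  refine ⟨fun i a => X a i, fun i b => X b i,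
    fun i c r p => ∑ s, X c i r s * φ (Pi.single i (Matrix.single p s 1)), fun a b c => ?_⟩
  have hprod : φ (X a * X b * X c) = groupTensor G a b c := by
    have hX : X a * X b * X c = e (MonoidAlgebra.single (a * b * c) 1) := by
      simp only [X, ← map_mul, MonoidAlgebra.single_mul_single, mul_one]
    rw [hX]
    change (e.symm (e (MonoidAlgebra.single (a * b * c) 1))).coeff 1 = _
    rw [e.symm_apply_apply]
    simp [groupTensor, Finsupp.single_apply]
  rw [← hprod, hφ]
  refine Finset.sum_congr rfl fun i _ => Finset.sum_congr rfl fun p _ => ?_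
  simp only [Pi.mul_apply, Matrix.mul_apply, Finset.sum_mul, Finset.mul_sum]
  calc _ = ∑ r, ∑ s, ∑ q, X a i p q * X b i q r * X c i r s *
        φ (Pi.single i (Matrix.single p s 1)) := Finset.sum_comm
    _ = ∑ r, ∑ q, ∑ s, X a i p q * X b i q r * X c i r s *
        φ (Pi.single i (Matrix.single p s 1)) := Finset.sum_congr rfl fun r _ => Finset.sum_comm
    _ = ∑ q, ∑ r, ∑ s, X a i p q * X b i q r * X c i r s *
        φ (Pi.single i (Matrix.single p s 1)) := Finset.sum_comm
    _ = _ := by simp only [mul_assoc]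

/-- The ranks of the powers of the group algebra tensor are governed by the character degrees. -/
theorem IsCharacterDegrees.exists_tensorRankLE {k : ℕ} {d : Fin k → ℕ}
    (hd : IsCharacterDegrees G d) {w C : ℝ} (hC : ∀ n : ℕ, 0 < n → ∃ R : ℕ,
      (R : ℝ) ≤ C * (n : ℝ) ^ w ∧ TensorRankLE (matMulTensor (Fin n) (Fin n) (Fin n)) R) (l : ℕ) :
    ∃ R : ℕ, (R : ℝ) ≤ C * (∑ i, (d i : ℝ) ^ w) ^ l ∧
      TensorRankLE (fun a b c : Fin l → G => ∏ t, groupTensor G (a t) (b t) (c t)) R := by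
  obtain ⟨hpos, ⟨e⟩⟩ := hd
  obtain ⟨A, B, D, hT⟩ := exists_groupTensor_eq_sum e
  -- Expanding the `l`-th power selects a block `f t` in each factor; tuples of indices then form
  -- one matrix multiplication of size ∏ d (f t).
  choose R hR hrank using fun f : Fin l → Fin k => hC (∏ t, d (f t))
    (Finset.prod_pos fun t _ => hpos _)
  refine ⟨∑ f, R f, ?_, ?_⟩
  · have hpow : (∑ i, (d i : ℝ) ^ w) ^ l = ∑ f : Fin l → Fin k, ∏ t, (d (f t) : ℝ) ^ w := by
      rw [Fintype.sum_pow]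
    rw [hpow, Finset.mul_sum]
    push_cast
    refine Finset.sum_le_sum fun f _ => (hR f).trans_eq ?_
    push_cast
    rw [Real.finsetProd_rpow _ _ fun t _ => (d (f t)).cast_nonneg]
  · have hsum : (fun a b c : Fin l → G => ∏ t, groupTensor G (a t) (b t) (c t)) =
        fun a b c => ∑ f : Fin l → Fin k, ∑ p : (t : Fin l) → Fin (d (f t)),
          ∑ q : (t : Fin l) → Fin (d (f t)), ∑ r : (t : Fin l) → Fin (d (f t)),
            (∏ t, A (f t) (a t) (p t) (q t)) * (∏ t, B (f t) (b t) (q t) (r t)) *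
              ∏ t, D (f t) (c t) (r t) (p t) := by
      funext a b c
      simp only [hT, Finset.prod_univ_sum, Fintype.piFinset_univ, ← Finset.prod_mul_distrib]
    have hterm (f : Fin l → Fin k) : TensorRankLE (fun a b c : Fin l → G =>
        ∑ p : (t : Fin l) → Fin (d (f t)), ∑ q : (t : Fin l) → Fin (d (f t)),
          ∑ r : (t : Fin l) → Fin (d (f t)),
            (∏ t, A (f t) (a t) (p t) (q t)) * (∏ t, B (f t) (b t) (q t) (r t)) *
              ∏ t, D (f t) (c t) (r t) (p t)) (R f) := by
      let E : ((t : Fin l) → Fin (d (f t))) ≃ Fin (∏ t, d (f t)) :=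
        Fintype.equivOfCardEq (by rw [Fintype.card_pi, Fintype.card_fin]; simp)
      have hE : TensorRankLE (matMulTensor ((t : Fin l) → Fin (d (f t)))
          ((t : Fin l) → Fin (d (f t))) ((t : Fin l) → Fin (d (f t)))) (R f) :=
        (hrank f).matMulTensor_congr E E E
      exact hE.of_matMulTensor (fun (a : Fin l → G) p q => ∏ t, A (f t) (a t) (p t) (q t))
        (fun (b : Fin l → G) q r => ∏ t, B (f t) (b t) (q t) (r t))
        (fun (c : Fin l → G) r p => ∏ t, D (f t) (c t) (r t) (p t))
    rw [hsum]
    exact TensorRankLE.sum hterm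

/-- If x < y, then C (x / y) ^ l tends to 0 while staying at least 1. This is how tensor powers
remove constants. -/
theorem le_of_forall_pow_le_mul_pow {x y C : ℝ} (hx : 0 ≤ x) (hy : 0 < y)
    (h : ∀ l : ℕ, 0 < l → y ^ l ≤ C * x ^ l) : y ≤ x := by
  by_contra! hlt
  have htend : Filter.Tendsto (fun l : ℕ => C * (x / y) ^ l) Filter.atTop (nhds (C * 0)) :=
    (tendsto_pow_atTop_nhds_zero_of_lt_one (by positivity) ((div_lt_one hy).2 hlt)).const_mul C
  have : (1 : ℝ) ≤ C * 0 := ge_of_tendsto htend <| by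
    filter_upwards [Filter.eventually_gt_atTop 0] with l hl
    rw [div_pow, ← mul_div_assoc, le_div_iff₀ (by positivity), one_mul]
    exact h l hl
  linarith

/-- The exponent of matrix multiplication is bounded by realizations in groups. -/
theorem Realizes.rpow_matMulExponent_le {n m p : ℕ} (h : Realizes G n m p) (hN : 2 ≤ n * m * p)
    {k : ℕ} {d : Fin k → ℕ} (hd : IsCharacterDegrees G d) :
    ((n * m * p : ℕ) : ℝ) ^ matMulExponent ≤ (∑ i, (d i : ℝ) ^ matMulExponent) ^ 3 := by
  classical
  obtain ⟨S₁, S₂, S₃, rfl, rfl, rfl, hS⟩ := h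
  set N := S₁.card * S₂.card * S₃.card with hN_def
  -- The constant C depends on ε, so ε stays fixed while `l` grows and tends to 0 only afterwards.
  have hstep : ∀ ε : ℝ, 0 < ε →
      (N : ℝ) ^ matMulExponent ≤ (∑ i, (d i : ℝ) ^ (matMulExponent + ε)) ^ 3 := by
    intro ε hε
    obtain ⟨C, hC⟩ := exists_tensorRankLE_rpow hε
    have hD : 0 ≤ ∑ i, (d i : ℝ) ^ (matMulExponent + ε) := by positivity
    refine le_of_forall_pow_le_mul_pow (C := C ^ 3) (by positivity)
      (Real.rpow_pos_of_pos (by positivity) _) fun l hl => ?_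
    obtain ⟨R, hR, hrank⟩ := hd.exists_tensorRankLE hC l
    have hcard : Fintype.card (Fin l → S₁) * Fintype.card (Fin l → S₂) *
        Fintype.card (Fin l → S₃) = N ^ l := by
      simp [hN_def, mul_pow]
    have hle := (hS.tensorRankLE hrank).rpow_matMulExponent_le
      (hcard ▸ hN.trans (Nat.le_self_pow hl.ne' N))
    rw [hcard] at hle
    calc ((N : ℝ) ^ matMulExponent) ^ l = ((N ^ l : ℕ) : ℝ) ^ matMulExponent := by
          push_cast
          exact Real.rpow_pow_comm (by positivity) _ _
      _ ≤ (R : ℝ) ^ 3 := hle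
      _ ≤ (C * (∑ i, (d i : ℝ) ^ (matMulExponent + ε)) ^ l) ^ 3 := by gcongr
      _ = _ := by ring
  have hcont : Continuous fun ε : ℝ => (∑ i, (d i : ℝ) ^ (matMulExponent + ε)) ^ 3 := by
    refine (continuous_finsetSum _ fun i _ => ?_).pow 3
    have hi : (d i : ℝ) ≠ 0 := by exact_mod_cast (hd.1 i).ne'
    exact Continuous.rpow continuous_const (by fun_prop) fun _ => Or.inl hi
  have htend := (hcont.tendsto 0).mono_left (nhdsWithin_le_nhds (s := Set.Ioi 0))
  simp only [add_zero] at htend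
  exact ge_of_tendsto htend (Filter.eventually_of_mem self_mem_nhdsWithin hstep)

end GroupTensor

end

/-! ### The bound in terms of the pseudo-exponent -/

theorem mainTheorem2 (G : Type*) [Group G] [Finite G] (α : ℝ) (hα : pseudoExponent G = α)
    {k : ℕ} (d : Fin k → ℕ) (hd : IsCharacterDegrees G d) :
    (Nat.card G : ℝ) ^ (matMulExponent / α) ≤ ∑ i, (d i : ℝ) ^ matMulExponent := by
  have hsum : 0 ≤ ∑ i, (d i : ℝ) ^ matMulExponent := by positivity
  rcases subsingleton_or_nontrivial G with hG | hG
  · obtain ⟨hpos, ⟨e⟩⟩ := hd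
    -- For trivial `G` the left side is 1, and one block suffices; there is one because ℂ[G] is
    -- nonzero.
    have hk : Nonempty (Fin k) := by
      by_contra hk
      rw [not_nonempty_iff] at hk
      exact not_subsingleton (MonoidAlgebra ℂ G) e.toEquiv.subsingleton
    obtain ⟨i⟩ := hk
    rw [Nat.card_of_subsingleton (1 : G), Nat.cast_one, Real.one_rpow]
    calc (1 : ℝ) ≤ (d i : ℝ) ^ matMulExponent :=
          Real.one_le_rpow (by exact_mod_cast hpos i) (zero_le_two.trans two_le_matMulExponent)
      _ ≤ _ := Finset.single_le_sum (f := fun i => (d i : ℝ) ^ matMulExponent)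
          (fun j _ => by positivity) (Finset.mem_univ i)
  · obtain ⟨n, m, p, hn, hm, hp, hne, hreal, hval⟩ := (isLeast_pseudoExponent G).1
    rw [hα] at hval
    have hN : 2 ≤ n * m * p := by
      have h₀ : 0 < n * m * p := by positivity
      have h₁ : n * m * p ≠ 1 := by simpa [mul_eq_one, and_assoc] using hne
      omega
    have hcard : (1 : ℝ) < Nat.card G := by exact_mod_cast Finite.one_lt_card
    have hlogG : 0 < Real.log (Nat.card G) := Real.log_pos hcard
    have hN₁ : (1 : ℝ) < (n * m * p : ℕ) := by exact_mod_cast hN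
    have hlogN : 0 < Real.log (n * m * p : ℕ) := Real.log_pos hN₁
    -- By the choice of realization, 3 log |G| / α = log (nmp).
    have hcube : ((Nat.card G : ℝ) ^ (matMulExponent / α)) ^ 3 =
        ((n * m * p : ℕ) : ℝ) ^ matMulExponent := by
      rw [Real.rpow_def_of_pos (by positivity), Real.rpow_def_of_pos (by positivity),
        ← Real.exp_nat_mul, hval]
      congr 1
      field_simp
      push_cast
      ring
    refine le_of_pow_le_pow_left₀ three_ne_zero hsum ?_
    rw [hcube]
    exact hreal.rpow_matMulExponent_le hN hd
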